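/- Let $(X,d)$ be a complete, locally compact, separable metric space and let $m$ be a Borel measure on $X$ that is finite on compact sets and strictly positive on non-empty open sets. Write $B(x,r)=\{y\in X: d(x,y)<r\}$. Let $(\mathcal E,\mathcal F)$ be a symmetric Dirichlet form on $L^2(X,m)$, i.e. a densely defined, symmetric, non-negative definite bilinear form that is closed ($\mathcal F$ is complete under $\mathcal E_1=\mathcal E+\langle\cdot,\cdot\rangle_{L^2(X,m)}$) and Markovian ($(u\vee 0)\wedge 1\in\mathcal F$ with $\mathcal E((u\vee 0)\wedge 1,(u\vee 0)\wedge 1)\le\mathcal E(u,u)$ for $u\in\mathcal F$). Assume that it is regular ($\mathcal F\cap C_c(X)$ is dense in $(\mathcal F,\mathcal E_1)$ and in $(C_c(X),\|\cdot\|_{\sup})$) and strongly local ($\mathcal E(u,v)=0$ for all $u,v\in\mathcal F$ such that the supports of the measures $|u|\,dm$, $|v|\,dm$ are compact and $v$ is $m$-a.e. constant in a neighbourhood of the support of $|u|\,dm$). For $f\in\mathcal F\cap L^\infty(X,m)$ let the energy measure $\Gamma(f,f)$ be the unique Borel measure with $\int_X g\,d\Gamma(f,f)=\mathcal E(f,fg)-\tfrac12\mathcal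 E(f^2,g)$ for all $g\in\mathcal F\cap C_c(X)$; for $f\in\mathcal F$ let $\Gamma(f,f)(S)=\lim_{n\to\infty}\Gamma(f_n,f_n)(S)$ for every Borel set $S$, where $f_n=(-n)\vee(f\wedge n)$. Let $\mathcal F_{\mathrm{loc}}$ be the set of $f\in L^2_{\mathrm{loc}}(X,m)$ such that for every relatively compact open $V\subset X$ there is $f^{\#}\in\mathcal F$ with $f=f^{\#}$ $m$-a.e. on $V$; for such $f$ let $\Gamma(f,f)$ be the Borel measure with $\Gamma(f,f)(V)=\Gamma(f^{\#},f^{\#})(V)$ for all such $V$ and $f^{\#}$. Let $\Psi$ be a continuous increasing bijection of $(0,\infty)$ onto itself for which there are constants $0<\beta_1<\beta_2$ and $C>1$ with $C^{-1}(R/r)^{\beta_1}\le\Psi(R)/\Psi(r)\le C(R/r)^{\beta_2}$ for all $0<r\le R$. Assume that all balls $B(x,r)$ are precompact and that the Poincaré inequality $\mathrm{PI}(\Psi)$ holds with constants $C_P,A\ge 1$: for all $x\in X$, $r>0$ and $f\in\mathcal F_{\mathrm{loc}}$, $$\int_{B(x,r)}(f-\overline f)^2\,dm\le C_P\,\Psi(r)\,\Gamma(f,f)(B(x,Ar)),\qquad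 \overline f=\frac1{m(B(x,r))}\int_{B(x,r)}f\,dm .$$ Then for all $x\in X$ and $r>0$ the ball $B(x,r)$ is chain connected in $B(x,Ar)$: for all $y,z\in B(x,r)$ and all $\epsilon>0$ there are $N\in\mathbb N$ and points $x_0=y,x_1,\dots,x_N=z$ in $B(x,Ar)$ with $d(x_i,x_{i+1})\le\epsilon$ for $0\le i<N$. -/

import Mathlib

open MeasureTheory Filter Topology Metric

/-- A symmetric Dirichlet form on `L²(X, m)`: a densely defined, symmetric, non-negative definite
bilinear form which is closed and Markovian. -/
structure DirichletForm {X : Type*} [MeasurableSpace X] (m : Measure X) where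
  /-- the domain `𝓕`, a linear subspace of `L²(X, m)` -/
  domain : Submodule ℝ (Lp ℝ 2 m)
  /-- the form `𝓔` on `𝓕 × 𝓕` -/
  form : domain →ₗ[ℝ] domain →ₗ[ℝ] ℝ
  dense_domain : Dense (domain : Set (Lp ℝ 2 m))
  symm : ∀ u v : domain, form u v = form v u
  nonneg : ∀ u : domain, 0 ≤ form u u
  /-- `𝓕` is complete for the inner product `𝓔₁ = 𝓔 + ⟨·,·⟩` of `L²(X, m)`. -/
  closed : ∀ u : ℕ → domain,
    Tendsto (fun p : ℕ × ℕ => form (u p.1 - u p.2) (u p.1 - u p.2) +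
      ‖((u p.1 - u p.2 : domain) : Lp ℝ 2 m)‖ ^ 2) atTop (𝓝 0) →
    ∃ v : domain, Tendsto (fun n : ℕ => form (u n - v) (u n - v) +
      ‖((u n - v : domain) : Lp ℝ 2 m)‖ ^ 2) atTop (𝓝 0)
  /-- The unit contraction operates on `𝓕`. -/
  markovian : ∀ u : domain, ∃ v : domain,
    ((v : Lp ℝ 2 m) : X → ℝ) =ᵐ[m] (fun x => min (max ((u : Lp ℝ 2 m) x) 0) 1) ∧
      form v v ≤ form u u

namespace DirichletForm

variable {X : Type*} [MetricSpace X] [MeasurableSpace X] {m : Measure X}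

/-- The class `u ∈ 𝓕` is represented by the function `φ`, which is continuous with compact
support; that is, `φ` is the function `u ∈ 𝓕 ∩ C_c(X)`. -/
def IsCcRep (D : DirichletForm m) (u : D.domain) (φ : X → ℝ) : Prop :=
  Continuous φ ∧ HasCompactSupport φ ∧ ((u : Lp ℝ 2 m) : X → ℝ) =ᵐ[m] φ

/-- Regularity: `𝓕 ∩ C_c(X)` is dense in `(𝓕, 𝓔₁)` and in `C_c(X)` with the sup norm. -/
def IsRegular (D : DirichletForm m) : Prop :=
  (∀ u : D.domain, ∀ ε : ℝ, 0 < ε → ∃ (v : D.domain) (φ : X → ℝ), D.IsCcRep v φ ∧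
    D.form (u - v) (u - v) + ‖((u - v : D.domain) : Lp ℝ 2 m)‖ ^ 2 < ε) ∧
  (∀ ψ : X → ℝ, Continuous ψ → HasCompactSupport ψ → ∀ ε : ℝ, 0 < ε →
    ∃ (v : D.domain) (φ : X → ℝ), D.IsCcRep v φ ∧ ∀ x, |ψ x - φ x| < ε)

/-- `supp_m[u]`: the topological support of the measure `|u| dm`. -/
def msupp (D : DirichletForm m) (u : D.domain) : Set X :=
  (m.withDensity (fun x => ‖(u : Lp ℝ 2 m) x‖ₑ)).support

/-- Strong locality: `𝓔(u, v) = 0` whenever `u, v` have compact supports and `v` is constant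
almost everywhere in a neighbourhood of the support of `u`. -/
def IsStronglyLocal (D : DirichletForm m) : Prop :=
  ∀ u v : D.domain, IsCompact (D.msupp u) → IsCompact (D.msupp v) →
    (∃ (U : Set X) (c : ℝ), IsOpen U ∧ D.msupp u ⊆ U ∧
      ∀ᵐ x ∂m, x ∈ U → (v : Lp ℝ 2 m) x = c) →
    D.form u v = 0

/-- `μ` is the energy measure `Γ(f, f)` of `f ∈ 𝓕 ∩ L^∞`: for all `g ∈ 𝓕 ∩ C_c(X)`,
`∫ g dμ = 𝓔(f, f g) - 𝓔(f², g) / 2`. The classes `p, q ∈ 𝓕` are those of `f g` and `f²`. -/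
def IsEnergyMeasureOfBounded (D : DirichletForm m) (f : D.domain) (μ : Measure X) : Prop :=
  ∀ (g : D.domain) (φ : X → ℝ), D.IsCcRep g φ → ∃ p q : D.domain,
    ((p : Lp ℝ 2 m) : X → ℝ) =ᵐ[m] (fun x => (f : Lp ℝ 2 m) x * φ x) ∧
    ((q : Lp ℝ 2 m) : X → ℝ) =ᵐ[m] (fun x => (f : Lp ℝ 2 m) x ^ 2) ∧
    Integrable φ μ ∧
    ∫ x, φ x ∂μ = D.form f p - (1 / 2) * D.form q g

/-- `μ` is the energy measure `Γ(f, f)` of `f ∈ 𝓕`: the setwise limit of the energy measures `ν n`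
of the truncations `h n = (-n) ∨ (f ∧ n)`. -/
def IsEnergyMeasure (D : DirichletForm m) (f : D.domain) (μ : Measure X) : Prop :=
  ∃ (h : ℕ → D.domain) (ν : ℕ → Measure X),
    (∀ n : ℕ, ((h n : Lp ℝ 2 m) : X → ℝ) =ᵐ[m]
      (fun x => max (-(n : ℝ)) (min ((f : Lp ℝ 2 m) x) n))) ∧
    (∀ n : ℕ, D.IsEnergyMeasureOfBounded (h n) (ν n)) ∧
    ∀ S : Set X, MeasurableSet S → Tendsto (fun n => ν n S) atTop (𝓝 (μ S))

/-- The local Dirichlet space `𝓕_loc`: functions in `L²_loc(X, m)` which on every relatively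
compact open set coincide almost everywhere with an element of `𝓕`. -/
def MemLoc (D : DirichletForm m) (f : X → ℝ) : Prop :=
  (∀ K : Set X, IsCompact K → MemLp f 2 (m.restrict K)) ∧
  ∀ V : Set X, IsOpen V → IsCompact (closure V) →
    ∃ u : D.domain, f =ᵐ[m.restrict V] ((u : Lp ℝ 2 m) : X → ℝ)

/-- `μ` is the energy measure `Γ(f, f)` of `f ∈ 𝓕_loc`: `μ(V) = Γ(u, u)(V)` for every relatively
compact open set `V` and every `u ∈ 𝓕` which agrees with `f` almost everywhere on `V`. -/
def IsLocalEnergyMeasure (D : DirichletForm m) (f : X → ℝ) (μ : Measure X) : Prop :=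
  ∀ V : Set X, IsOpen V → IsCompact (closure V) → ∀ u : D.domain,
    f =ᵐ[m.restrict V] ((u : Lp ℝ 2 m) : X → ℝ) →
    ∃ ν : Measure X, D.IsEnergyMeasure u ν ∧ μ V = ν V

open scoped Classical in
/-- The energy measure `Γ(f, f)` of `f ∈ 𝓕_loc`. For a strongly local regular form on a locally
compact separable metric space and `f ∈ 𝓕_loc` there is exactly one measure as described by
`IsLocalEnergyMeasure`, so that the default value is not used. -/
noncomputable def energyMeasure (D : DirichletForm m) (f : X → ℝ) : Measure X :=
  if h : ∃ μ : Measure X, D.IsLocalEnergyMeasure f μ then h.choose else 0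

/-- The Poincaré inequality `PI(Ψ)` with the constants `C_P` and `A`. -/
def PoincareInequality (D : DirichletForm m) (Ψ : ℝ → ℝ) (C_P A : ℝ) : Prop :=
  1 ≤ C_P ∧ 1 ≤ A ∧
  ∀ (x : X) (r : ℝ), 0 < r → ∀ f : X → ℝ, D.MemLoc f →
    ∫⁻ y in ball x r, ENNReal.ofReal ((f y - ⨍ z in ball x r, f z ∂m) ^ 2) ∂m ≤
      ENNReal.ofReal (C_P * Ψ r) * D.energyMeasure f (ball x (A * r))

end DirichletForm

/-- The standing assumption on the space-time scaling function: `Ψ` is a continuous increasing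
bijection of `(0, ∞)` onto itself, with upper and lower power bounds on its growth. -/
def IsScaleFunction (Ψ : ℝ → ℝ) : Prop :=
  ContinuousOn Ψ (Set.Ioi 0) ∧ StrictMonoOn Ψ (Set.Ioi 0) ∧
  Set.BijOn Ψ (Set.Ioi 0) (Set.Ioi 0) ∧
  ∃ β₁ β₂ C : ℝ, 0 < β₁ ∧ β₁ < β₂ ∧ 1 < C ∧ ∀ r R : ℝ, 0 < r → r ≤ R →
    C⁻¹ * (R / r) ^ β₁ ≤ Ψ R / Ψ r ∧ Ψ R / Ψ r ≤ C * (R / r) ^ β₂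

/-- `s 0, …, s N` is an `ε`-chain in `B` between `x` and `y`. -/
def IsEpsChain {X : Type*} [MetricSpace X] (ε : ℝ) (B : Set X) (x y : X) (N : ℕ) (s : ℕ → X) :
    Prop :=
  s 0 = x ∧ s N = y ∧ (∀ i < N, dist (s i) (s (i + 1)) ≤ ε) ∧ ∀ i ≤ N, s i ∈ B

/-- `N_ε(x, y; B)`: the least length of an `ε`-chain in `B` between `x` and `y`, or `∞`. -/
noncomputable def chainNumber {X : Type*} [MetricSpace X] (ε : ℝ) (x y : X) (B : Set X) : ℕ∞ :=
  ⨅ (n : ℕ) (_ : ∃ s : ℕ → X, IsEpsChain ε B x y n s), (n : ℕ∞)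

/-- `B₁` is chain connected in `B₂`. -/
def ChainConnectedIn {X : Type*} [MetricSpace X] (B₁ B₂ : Set X) : Prop :=
  B₁ ⊆ B₂ ∧ ∀ x ∈ B₁, ∀ y ∈ B₁, ∀ ε : ℝ, 0 < ε → chainNumber ε x y B₂ < ⊤

/-! A Poincaré inequality forbids a function that jumps without energy. If no `ε`-chain in `B(x,
Ar)` joins `y` to `z`, the points reachable from `y` and the remaining points split `B(x, Ar)` into
two open sets (`isOpen_epsChain_reachable`). On a slightly smaller closed ball the two pieces are
disjoint compact sets, and regularity gives `f ∈ 𝓕 ∩ C_c(X)` equal to 1 near one and 0 near the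
other.

Strong locality makes `Γ(f, f)` vanish wherever `f` is locally constant: if `f = c` near the support
of `χ`, then `fχ = cχ`, and both terms of `∫ χ dΓ(f, f) = 𝓔(f, fχ) - 𝓔(f², χ) / 2` are zero. The
Poincaré inequality then forces `f(y) = f(z)`, contradicting `f(y) = 1`, `f(z) = 0`. -/

namespace DirichletForm

variable {X : Type*} [MetricSpace X] [MeasurableSpace X] {m : Measure X} {D : DirichletForm m}

theorem IsCcRep.sub {u v : D.domain} {φ χ : X → ℝ} (hu : D.IsCcRep u φ) (hv : D.IsCcRep v χ) :
    D.IsCcRep (u - v) (fun x => φ x - χ x) := by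
  refine ⟨hu.1.sub hv.1, hu.2.1.sub hv.2.1, ?_⟩
  filter_upwards [Lp.coeFn_sub (u : Lp ℝ 2 m) (v : Lp ℝ 2 m), hu.2.2, hv.2.2] with x h h1 h2
  exact h.trans (by rw [Pi.sub_apply, h1, h2])

theorem IsCcRep.const_mul {u : D.domain} {φ : X → ℝ} (hu : D.IsCcRep u φ) (a : ℝ) :
    D.IsCcRep (a • u) (fun x => a * φ x) := by
  refine ⟨hu.1.const_smul a, hu.2.1.smul_left (f := fun _ => a), ?_⟩
  filter_upwards [Lp.coeFn_smul a (u : Lp ℝ 2 m), hu.2.2] with x h h1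
  simp [h, h1]

/-- The truncation to `[0, a]` operates on `𝓕 ∩ C_c(X)`. -/
theorem IsCcRep.exists_clip {u : D.domain} {φ : X → ℝ} (hu : D.IsCcRep u φ) {a : ℝ} (ha : 0 < a) :
    ∃ v : D.domain, D.IsCcRep v (fun x => min (max (φ x) 0) a) := by
  obtain ⟨v, hv, -⟩ := D.markovian (a⁻¹ • u)
  have hw : D.IsCcRep v (fun x => min (max (a⁻¹ * φ x) 0) 1) := by
    refine ⟨?_, ?_, ?_⟩
    · have := hu.1
      fun_prop
    · exact hu.2.1.comp_left (g := fun t => min (max (a⁻¹ * t) 0) 1) (by simp)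
    · filter_upwards [hv, (hu.const_mul a⁻¹).2.2] with x h h1
      rw [h, h1]
  have key : (fun x => min (max (φ x) 0) a) = fun x => a * min (max (a⁻¹ * φ x) 0) 1 := by
    funext x
    rw [mul_min_of_nonneg _ _ ha.le, mul_max_of_nonneg _ _ ha.le, mul_inv_cancel_left₀ ha.ne']
    simp
  exact ⟨a • v, key ▸ hw.const_mul a⟩

theorem IsCcRep.memLoc {u : D.domain} {φ : X → ℝ} (hu : D.IsCcRep u φ) : D.MemLoc φ :=
  ⟨fun _ _ => ((memLp_congr_ae hu.2.2).1 (Lp.memLp _)).restrict _,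
    fun _ _ _ => ⟨u, ae_restrict_of_ae hu.2.2.symm⟩⟩

/-- The energy measure of a bounded `u ∈ 𝓕` vanishes on every set which is null for all measures
satisfying the integral identity for `u`. -/
theorem IsEnergyMeasure.measure_eq_zero {u : D.domain} {μ : Measure X} (hμ : D.IsEnergyMeasure u μ)
    {M : ℝ} (hM : ∀ᵐ x ∂m, |(u : Lp ℝ 2 m) x| ≤ M) {S : Set X} (hS : MeasurableSet S)
    (h : ∀ ν : Measure X, D.IsEnergyMeasureOfBounded u ν → ν S = 0) : μ S = 0 := by
  obtain ⟨t, ν, ht, hν, hlim⟩ := hμ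
  refine tendsto_nhds_unique (hlim S hS) (tendsto_const_nhds.congr' ?_)
  -- From `n ≥ M` on, truncating at level `n` leaves `u` unchanged, so `ν n` satisfies the identity
  -- for `u` itself.
  filter_upwards [eventually_ge_atTop ⌈M⌉₊] with n hn
  have hMn : M ≤ n := Nat.ceil_le.1 hn
  have htu : t n = u := by
    refine Subtype.ext (Lp.ext ?_)
    filter_upwards [ht n, hM] with x h1 h2
    obtain ⟨h3, h4⟩ := abs_le.1 (h2.trans hMn)
    rw [h1, min_eq_left h4, max_eq_right h3]
  exact (h _ (htu ▸ hν n)).symm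

/-! ### Strong locality and vanishing energy. -/

variable [BorelSpace X]

theorem IsCcRep.msupp_subset {u : D.domain} {φ : X → ℝ} (hu : D.IsCcRep u φ) :
    D.msupp u ⊆ tsupport φ := by
  refine Measure.support_subset_of_isClosed (isClosed_tsupport φ) ?_
  rw [mem_ae_iff, withDensity_apply _ (isClosed_tsupport φ).measurableSet.compl,
    setLIntegral_eq_zero_iff (isClosed_tsupport φ).measurableSet.compl
      (Lp.stronglyMeasurable (u : Lp ℝ 2 m)).measurable.enorm]
  filter_upwards [hu.2.2] with x h hx
  simp [h, image_eq_zero_of_notMem_tsupport hx]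

theorem IsCcRep.isCompact_msupp {u : D.domain} {φ : X → ℝ} (hu : D.IsCcRep u φ) :
    IsCompact (D.msupp u) :=
  hu.2.1.isCompact.of_isClosed_subset Measure.isClosed_support hu.msupp_subset

theorem IsStronglyLocal.form_eq_zero (hloc : D.IsStronglyLocal) {u v : D.domain} {φ χ : X → ℝ}
    (hu : D.IsCcRep u φ) (hv : D.IsCcRep v χ) {O : Set X} (hO : IsOpen O) (hφ : tsupport φ ⊆ O)
    (c : ℝ) (hc : ∀ x ∈ O, χ x = c) : D.form u v = 0 := by
  refine hloc u v hu.isCompact_msupp hv.isCompact_msupp ⟨O, c, hO, hu.msupp_subset.trans hφ, ?_⟩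
  filter_upwards [hv.2.2] with x h hx
  rw [h, hc x hx]

/-- The energy measure of a function in `𝓕 ∩ C_c(X)` does not charge the set where `χ > 0`, if
`χ ∈ 𝓕 ∩ C_c(X)` is non-negative and the function is constant near the support of `χ`. -/
theorem IsEnergyMeasureOfBounded.measure_pos_eq_zero (hloc : D.IsStronglyLocal)
    {u w : D.domain} {φ χ : X → ℝ} {μ : Measure X} (hμ : D.IsEnergyMeasureOfBounded u μ)
    (hu : D.IsCcRep u φ) (hw : D.IsCcRep w χ) (hχ : ∀ x, 0 ≤ χ x) {O : Set X} (hO : IsOpen O)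
    (hsupp : tsupport χ ⊆ O) (c : ℝ) (hc : ∀ x ∈ O, φ x = c) : μ {x | 0 < χ x} = 0 := by
  obtain ⟨p, q, hp, hq, hint, hpq⟩ := hμ w χ hw
  -- On `O` the factor `φ` is `c`; off `O` both sides vanish with `χ`.
  have hp' : p = c • w := by
    refine Subtype.ext (Lp.ext ?_)
    filter_upwards [hp, hu.2.2, (hw.const_mul c).2.2] with x h h1 h2
    rw [h, h1, h2]
    by_cases hx : x ∈ O
    · rw [hc x hx]
    · rw [image_eq_zero_of_notMem_tsupport fun h => hx (hsupp h), mul_zero, mul_zero]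
  have hq' : D.IsCcRep q (fun x => φ x ^ 2) := by
    refine ⟨hu.1.pow 2, hu.2.1.comp_left (g := fun t => t ^ 2) (by simp), ?_⟩
    filter_upwards [hq, hu.2.2] with x h h1
    rw [h, h1]
  have h1 : D.form u p = 0 := by
    rw [hp', map_smul, D.symm, hloc.form_eq_zero hw hu hO hsupp c hc, smul_zero]
  have h2 : D.form q w = 0 := by
    rw [D.symm]
    exact hloc.form_eq_zero hw hq' hO hsupp (c ^ 2) fun x hx => by rw [hc x hx]
  rw [h1, h2, mul_zero, sub_zero, integral_eq_zero_iff_of_nonneg hχ hint] at hpq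
  rw [← nonpos_iff_eq_zero]
  refine (measure_mono fun x hx => ?_).trans (ae_iff.1 hpq).le
  exact ne_of_gt hx

/-- `energyMeasure` is a choice, so the vanishing is asked of every candidate measure and no
uniqueness is needed; the default value 0 is harmless here. -/
theorem energyMeasure_eq_zero {u : D.domain} {φ : X → ℝ} (hu : D.IsCcRep u φ) {M : ℝ}
    (hM : ∀ x, |φ x| ≤ M) {V : Set X} (hV : IsOpen V) (hVc : IsCompact (closure V))
    (h : ∀ ν : Measure X, D.IsEnergyMeasureOfBounded u ν → ν V = 0) :
    D.energyMeasure φ V = 0 := by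
  unfold energyMeasure
  split_ifs with hex
  · obtain ⟨ν, hν, hνV⟩ := hex.choose_spec V hV hVc u (ae_restrict_of_ae hu.2.2.symm)
    rw [hνV]
    refine hν.measure_eq_zero (M := M) ?_ hV.measurableSet h
    filter_upwards [hu.2.2] with x hx
    rw [hx]
    exact hM x
  · simp

/-- For disjoint compact sets `K₁`, `K₀` there is a function in `𝓕 ∩ C_c(X)` which is `1` on `K₁`
and `0` on `K₀`, and whose energy measure does not charge the open subsets of `K₁ ∪ K₀`. -/
theorem exists_separating_energyMeasure_eq_zero [LocallyCompactSpace X] (hreg : D.IsRegular)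
    (hloc : D.IsStronglyLocal) {K₁ K₀ : Set X} (hK₁ : IsCompact K₁) (hK₀ : IsCompact K₀)
    (hd : Disjoint K₁ K₀) :
    ∃ (u : D.domain) (φ : X → ℝ), D.IsCcRep u φ ∧ (∀ x ∈ K₁, φ x = 1) ∧ (∀ x ∈ K₀, φ x = 0) ∧
      ∀ V : Set X, IsOpen V → IsCompact (closure V) → V ⊆ K₁ ∪ K₀ → D.energyMeasure φ V = 0 := by
  obtain ⟨g₁, h11, h10, hg₁, -⟩ := exists_continuous_one_zero_of_isCompact hK₁ hK₀.isClosed hd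
  obtain ⟨g₀, h00, h01, hg₀, -⟩ := exists_continuous_one_zero_of_isCompact hK₀ hK₁.isClosed hd.symm
  -- The target is `3` on `K₁` and `-3` on `K₀`; an error below 1 leaves room between the levels 0,
  -- 1 used for `u` and the levels of the test functions.
  obtain ⟨v, η, hv, hη⟩ := hreg.2 (fun x => 3 * (g₁ x - g₀ x)) (by fun_prop)
    ((hg₁.sub hg₀).comp_left (g := fun t => 3 * t) (by simp)) 1 one_pos
  have hη₁ : ∀ x ∈ K₁, 2 < η x := fun x hx => by
    have := (abs_lt.1 (hη x)).2
    simp only [h11 hx, h01 hx, Pi.one_apply, Pi.zero_apply] at this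
    linarith
  have hη₀ : ∀ x ∈ K₀, 2 < -1 * η x := fun x hx => by
    have := (abs_lt.1 (hη x)).1
    simp only [h10 hx, h00 hx, Pi.one_apply, Pi.zero_apply] at this
    linarith
  -- the truncations of `η` and `-η` used as test functions
  have test : ∀ {w : D.domain} {θ : X → ℝ}, D.IsCcRep w θ → ∀ {a b : ℝ}, 0 < a → a < b →
      ∃ (w' : D.domain) (χ : X → ℝ), D.IsCcRep w' χ ∧ (∀ x, 0 ≤ χ x) ∧
        tsupport χ ⊆ {x | a ≤ θ x} ∧ ∀ x, a < θ x → 0 < χ x := by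
    intro w θ hw a b ha hab
    obtain ⟨w₁, hw₁⟩ := hw.exists_clip (ha.trans hab)
    obtain ⟨w₂, hw₂⟩ := hw.exists_clip ha
    -- The truncations at heights `b` and `a` agree exactly where `θ ≤ a`.
    refine ⟨w₁ - w₂, _, hw₁.sub hw₂, fun x => ?_, ?_, fun x hx => ?_⟩
    · exact sub_nonneg.2 (min_le_min_left _ hab.le)
    · refine closure_minimal (fun x hx => ?_) (isClosed_le continuous_const hw.1)
      by_contra hxa
      rw [Set.mem_ofPred_eq, not_le] at hxa
      refine hx (sub_eq_zero.2 ?_)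
      rw [min_eq_left (max_le (hxa.trans hab).le (ha.trans hab).le),
        min_eq_left (max_le hxa.le ha.le)]
    · rw [sub_pos, max_eq_left (ha.trans hx).le, min_eq_right hx.le]
      exact lt_min hx hab
  obtain ⟨u, hu⟩ := hv.exists_clip one_pos
  -- The support of `χ₁` lies in `{η ≥ 2}`, inside the open set `{η > 1}` where the clipped `η` is
  -- 1; that of `χ₀` lies in `{η ≤ -1}`, inside `{η < 0}` where it is 0.
  obtain ⟨w₁, χ₁, hw₁, hχ₁, hs₁, hpos₁⟩ := test hv (a := 2) (b := 3) (by norm_num) (by norm_num)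
  obtain ⟨w₀, χ₀, hw₀, hχ₀, hs₀, hpos₀⟩ :=
    test (hv.const_mul (-1)) (a := 1) (b := 2) (by norm_num) (by norm_num)
  refine ⟨u, _, hu, fun x hx => ?_, fun x hx => ?_, fun V hV hVc hVK => ?_⟩
  · have := hη₁ x hx
    exact min_eq_right (le_max_of_le_left (by linarith))
  · have := hη₀ x hx
    rw [max_eq_right (by linarith), min_eq_left zero_le_one]
  · refine energyMeasure_eq_zero hu (M := 1) (fun x => ?_) hV hVc fun ν hν => ?_
    · rw [abs_of_nonneg (le_min (le_max_right _ _) zero_le_one)]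
      exact min_le_right _ _
    · have n₁ : ν {x | 0 < χ₁ x} = 0 :=
        hν.measure_pos_eq_zero hloc hu hw₁ hχ₁ (O := {x | 1 < η x})
          (isOpen_lt continuous_const hv.1)
          (hs₁.trans fun x (hx : 2 ≤ η x) => show 1 < η x by linarith) 1
          fun x hx => min_eq_right (le_max_of_le_left (le_of_lt hx))
      have n₀ : ν {x | 0 < χ₀ x} = 0 :=
        hν.measure_pos_eq_zero hloc hu hw₀ hχ₀ (O := {x | η x < 0})
          (isOpen_lt hv.1 continuous_const)
          (hs₀.trans fun x (hx : 1 ≤ -1 * η x) => show η x < 0 by linarith) 0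
          fun x hx => by rw [max_eq_right (le_of_lt hx), min_eq_left zero_le_one]
      refine measure_mono_null (fun x hx => ?_) (measure_union_null n₁ n₀)
      rcases hVK hx with hx | hx
      · exact Or.inl (hpos₁ x (hη₁ x hx))
      · exact Or.inr (hpos₀ x (one_lt_two.trans (hη₀ x hx)))

/-- Under the Poincaré inequality a continuous function in `𝓕_loc` without energy on `B(x, A r)` is
constant on `B(x, r)`. -/
theorem PoincareInequality.eq_of_energyMeasure_eq_zero [m.IsOpenPosMeasure] {Ψ : ℝ → ℝ}
    {C_P A : ℝ} (hPI : D.PoincareInequality Ψ C_P A) {x : X} {r : ℝ} (hr : 0 < r) {f : X → ℝ}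
    (hf : D.MemLoc f) (hcont : Continuous f) (h0 : D.energyMeasure f (ball x (A * r)) = 0)
    {y z : X} (hy : y ∈ ball x r) (hz : z ∈ ball x r) : f y = f z := by
  have h := hPI.2.2 x r hr f hf
  rw [h0, mul_zero, nonpos_iff_eq_zero, lintegral_eq_zero_iff (by fun_prop)] at h
  set c := ⨍ z in ball x r, f z ∂m
  have hae : f =ᵐ[m.restrict (ball x r)] fun _ => c := by
    filter_upwards [h] with w hw
    have := ENNReal.ofReal_eq_zero.1 hw
    exact sub_eq_zero.1 (pow_eq_zero_iff two_ne_zero |>.1 (le_antisymm this (sq_nonneg _)))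
  -- Since `m` charges every non-empty open set, continuity upgrades a.e. equality to equality.
  have heq : Set.EqOn f (fun _ => c) (ball x r) :=
    Measure.eqOn_open_of_ae_eq hae isOpen_ball hcont.continuousOn continuousOn_const
  rw [heq hy, heq hz]

end DirichletForm

section Chains

variable {X : Type*} [MetricSpace X]

theorem IsEpsChain.extend {ε : ℝ} {B : Set X} {x y z : X} {N : ℕ} {s : ℕ → X}
    (hs : IsEpsChain ε B x y N s) (hz : z ∈ B) (hyz : dist y z ≤ ε) :
    IsEpsChain ε B x z (N + 1) (fun i => if i ≤ N then s i else z) := by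
  obtain ⟨h0, hN, hstep, hB⟩ := hs
  refine ⟨by simpa using h0, by simp, fun i hi => ?_, fun i hi => ?_⟩
  · rcases (Nat.lt_succ_iff.1 hi).lt_or_eq with h | rfl
    · simpa [h.le, Nat.succ_le_of_lt h] using hstep i h
    · simpa [hN] using hyz
  · dsimp only
    split_ifs with h
    · exact hB i h
    · exact hz

theorem chainNumber_lt_top {ε : ℝ} {x y : X} {B : Set X}
    (h : ∃ (N : ℕ) (s : ℕ → X), IsEpsChain ε B x y N s) : chainNumber ε x y B < ⊤ := by
  obtain ⟨N, hN⟩ := h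
  exact (iInf₂_le N hN).trans_lt (ENat.natCast_lt_top N)

/-- The points of an open set which `ε`-chains from `y` reach, respectively do not reach, form
open sets. -/
theorem isOpen_epsChain_reachable {ε : ℝ} (hε : 0 < ε) {B : Set X} (hB : IsOpen B) (y : X) :
    IsOpen {w | ∃ (N : ℕ) (s : ℕ → X), IsEpsChain ε B y w N s} ∧
      IsOpen (B \ {w | ∃ (N : ℕ) (s : ℕ → X), IsEpsChain ε B y w N s}) := by
  constructor
  · rw [isOpen_iff_mem_nhds]
    rintro w ⟨N, s, hs⟩
    have hw : w ∈ B := hs.2.1 ▸ hs.2.2.2 N le_rfl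
    filter_upwards [hB.mem_nhds hw, ball_mem_nhds w hε] with v hv hvw
    exact ⟨N + 1, _, hs.extend hv (mem_ball'.1 hvw).le⟩
  · rw [isOpen_iff_mem_nhds]
    rintro w ⟨hw, hwn⟩
    filter_upwards [hB.mem_nhds hw, ball_mem_nhds w hε] with v hv hvw
    refine ⟨hv, ?_⟩
    rintro ⟨N, s, hs⟩
    exact hwn ⟨N + 1, _, hs.extend hw (mem_ball.1 hvw).le⟩

end Chains

theorem proposition2 {X : Type*} [MetricSpace X] [CompleteSpace X] [LocallyCompactSpace X]
    [TopologicalSpace.SeparableSpace X] [MeasurableSpace X] [BorelSpace X]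
    (m : Measure X) [IsFiniteMeasureOnCompacts m] [m.IsOpenPosMeasure]
    (D : DirichletForm m) (hreg : D.IsRegular) (hloc : D.IsStronglyLocal)
    (hball : ∀ (x : X) (r : ℝ), 0 < r → IsCompact (closure (ball x r)))
    (Ψ : ℝ → ℝ) (hΨ : IsScaleFunction Ψ)
    (C_P A : ℝ) (hPI : D.PoincareInequality Ψ C_P A) :
    ∀ (x : X) (r : ℝ), 0 < r → ChainConnectedIn (ball x r) (ball x (A * r)) := by
  intro x r hr
  have hA : 1 ≤ A := hPI.2.1
  have hsub : ball x r ⊆ ball x (A * r) := ball_subset_ball (le_mul_of_one_le_left hr.le hA)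
  refine ⟨hsub, fun y hy z hz ε hε => chainNumber_lt_top ?_⟩
  by_contra hcon
  -- Shrinking the radius puts a compact ball of radius `A * r'` inside the open ball `B(x, Ar)`,
  -- where `U` and its complement are both relatively closed.
  obtain ⟨r', hr', hr'r⟩ := exists_between (max_lt (mem_ball.1 hy) (mem_ball.1 hz))
  have hy' : y ∈ ball x r' := mem_ball.2 ((le_max_left _ _).trans_lt hr')
  have hz' : z ∈ ball x r' := mem_ball.2 ((le_max_right _ _).trans_lt hr')
  have hr'0 : 0 < r' := dist_nonneg.trans_lt (mem_ball.1 hy')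
  have hAr : A * r' < A * r := mul_lt_mul_of_pos_left hr'r (one_pos.trans_le hA)
  have hAr'0 : 0 < A * r' := mul_pos (one_pos.trans_le hA) hr'0
  have hsub' : ball x r' ⊆ closedBall x (A * r') :=
    (ball_subset_ball (le_mul_of_one_le_left hr'0.le hA)).trans ball_subset_closedBall
  obtain ⟨hU, hW⟩ := isOpen_epsChain_reachable hε (isOpen_ball (x := x) (ε := A * r)) y
  set U := {w | ∃ (N : ℕ) (s : ℕ → X), IsEpsChain ε (ball x (A * r)) y w N s}
  have hyU : y ∈ U := ⟨0, fun _ => y, rfl, rfl, by simp, fun _ _ => hsub hy⟩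
  have hcpt : IsCompact (closedBall x (A * r')) :=
    (hball x (A * r) (hAr'0.trans hAr)).of_isClosed_subset isClosed_closedBall
      ((closedBall_subset_ball hAr).trans subset_closure)
  have hmem : ∀ w ∈ closedBall x (A * r'), w ∈ U ∨ w ∈ ball x (A * r) \ U := fun w hw =>
    (em (w ∈ U)).imp_right fun h => ⟨closedBall_subset_ball hAr hw, h⟩
  obtain ⟨u, f, hu, hf₁, hf₀, henergy⟩ :=
    DirichletForm.exists_separating_energyMeasure_eq_zero hreg hloc
      -- Removing one open piece from the compact ball leaves its intersection with the other.
      (hcpt.diff hW) (hcpt.diff hU)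
      (Set.disjoint_left.2 fun w h₁ h₀ => (hmem w h₁.1).elim h₀.2 h₁.2)
  have h0 : D.energyMeasure f (ball x (A * r')) = 0 :=
    henergy _ isOpen_ball (hball x _ hAr'0) fun w hw =>
      (em (w ∈ U)).imp (fun h => ⟨ball_subset_closedBall hw, fun h' => h'.2 h⟩)
        fun h => ⟨ball_subset_closedBall hw, h⟩
  have heq := hPI.eq_of_energyMeasure_eq_zero hr'0 hu.memLoc hu.1 h0 hy' hz'
  rw [hf₁ y ⟨hsub' hy', fun h => h.2 hyU⟩, hf₀ z ⟨hsub' hz', hcon⟩] at heq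
  exact one_ne_zero heq
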